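/- Let $K\subset\mathbb R^2$ be a compact body, i.e. a non-empty compact set that equals the closure of its interior, and let $\mu$ be a measure on the Borel $\sigma$-algebra of $K$. Assume * (C.1) $K$ is connected; * (C.2) $\mu(B(p,\varepsilon)\cap K)>0$ for all $p\in K$ and $\varepsilon>0$, where $B(p,\varepsilon)$ is the open Euclidean ball of radius $\varepsilon$ around $p$; * (C.3) $\mu(\{(\alpha,\beta)\in K:\alpha=x\})=\mu(\{(\alpha,\beta)\in K:\beta=y\})=0$ for all $x,y\in\mathbb R$; * (C.4) $\mu$ is a probability measure on $K$. Define the generalized conic function $F_{K,\mu}:\mathbb R^2\to\mathbb R$ by $$F_{K,\mu}(x,y)=\int_K\bigl(|x-\alpha|+|y-\beta|\bigr)\,\mu(d\alpha,d\beta).$$ Let $(t_k)_{k\ge1}$ be a decreasing (not necessarily strictly) sequence of positive numbers with $\sum_{k\ge1}t_k=\infty$ and $\sum_{k\ge1}t_k^2<\infty$, let $(P_k)_{k\ge1}$ be independent random variables on a probability space, with values in $\mathbb R^2$ and common distribution $\mu$, and let $x_0\in K$. Define $(X_k)_{k\ge0}$ by $$X_0=x_0,\qquad X_{k+1}=X_k-t_{k+1}Q_{k+1}\quad(k\ge0),$$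 where, for $i=1,2$, the $i$-th coordinate of $Q_{k+1}$ is $Q_{k+1}^{(i)}=1$ if $X_k^{(i)}\ge P_{k+1}^{(i)}$ and $Q_{k+1}^{(i)}=-1$ if $X_k^{(i)}<P_{k+1}^{(i)}$. Then $F_{K,\mu}$ has a unique global minimizer $X^*\in\mathbb R^2$, and $F_{K,\mu}(X_k)$ converges to $F_{K,\mu}(X^*)$ as $k\to\infty$ almost surely and in $L^q$ for every integer $q\ge1$; that is, $\mathbb P\bigl(\lim_{k\to\infty}F_{K,\mu}(X_k)=F_{K,\mu}(X^*)\bigr)=1$, and for every integer $q\ge1$ all $F_{K,\mu}(X_k)$ lie in $L^q$ and $\lim_{k\to\infty}\mathbb E\,|F_{K,\mu}(X_k)-F_{K,\mu}(X^*)|^q=0$. -/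

import Mathlib

open MeasureTheory ProbabilityTheory Filter Topology

/-- The plane `ℝ²` with its Euclidean norm; the two coordinates of `p` are `p 0` and `p 1`. -/
abbrev Plane : Type := EuclideanSpace ℝ (Fin 2)

/-- A compact body: a non-empty compact set that is the closure of its interior. -/
structure IsCompactBody (K : Set Plane) : Prop where
  nonempty : K.Nonempty
  isCompact : IsCompact K
  closure_interior : closure (interior K) = K

/-- The taxicab distance `d₁((x, y), (α, β)) = |x - α| + |y - β|`. -/
def taxicabDist (p a : Plane) : ℝ := |p 0 - a 0| + |p 1 - a 1|

/-- The generalized conic function `F_{K,μ}(p) = ∫_K d₁(p, a) μ(da)` of a set `K` and a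
(finite) Borel measure `μ` on `K`. -/
noncomputable def conicFunction (K : Set Plane) (μ : Measure K) (p : Plane) : ℝ :=
  ∫ a : K, taxicabDist p (a : Plane) ∂μ

/-- The step direction from the current position `x` when the point `p` is sampled: the
`i`-th coordinate is `1` if `x i ≥ p i` and `-1` if `x i < p i`. -/
noncomputable def stepDirection (x p : Plane) : Plane :=
  !₂[if p 0 ≤ x 0 then 1 else -1, if p 1 ≤ x 1 then 1 else -1]

/-- The stochastic algorithm `X₀ = x₀`, `X_{k+1} = X_k - t_{k+1} Q_{k+1}`, where `Q_{k+1}` is the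
step direction determined by `X_k` and the sample `P_{k+1}`. The values `t 0`, `P 0` are not
used. -/
noncomputable def conicIterate {Ω : Type*} (x₀ : Plane) (t : ℕ → ℝ) (P : ℕ → Ω → Plane) :
    ℕ → Ω → Plane
  | 0, _ => x₀
  | k + 1, ω =>
      conicIterate x₀ t P k ω
        - t (k + 1) • stepDirection (conicIterate x₀ t P k ω) (P (k + 1) ω)

/-!
The taxicab distance is a sum over the two coordinates, so the conic function is the sum
`meanDist ν₀ (p 0) + meanDist ν₁ (p 1)`, where `ν₀`, `ν₁` are the coordinate laws of `μ` and
`meanDist ν u = ∫ |u - a| ν(da)`; likewise each coordinate of the algorithm is a stochastic median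
search on the line (`conicIterate_apply`). Everything but the final combination is therefore about
a law `ν` on `ℝ`.

*The minimizer.* The expected step `meanStep ν x = 2 ν (-∞, x] - 1` is a subgradient of `meanDist ν`
at `x` (`meanDist_add_le`). Since lines are null sets, the coordinate laws have no atoms; since `K`
is connected and `μ` charges every ball around a point of `K`, they charge every open subinterval
of the interval onto which `K` projects. Hence `meanStep ν` vanishes at exactly one point `m` and
has the sign of `x - m` elsewhere (`exists_isStrictMedian`), which makes `m` the unique minimizer
(`IsStrictMedian.meanDist_lt`).

*Almost sure convergence.* The squared distance of the iterate `x k` to `m` changes in one step by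
`s k ^ 2 - 2 s k (x k - m) medianStep (x k) (q k)`. As the sample `q k` is independent of the past,
adding up the conditional expectations of these increments and subtracting them gives a martingale
(`martingale_medianMartingale`). The drift terms `(x k - m) * meanStep ν (x k)` are nonnegative, so
the martingale is bounded below by `-∑ s k ^ 2` and converges almost surely. On a path on which it
converges, `∑ s k (x k - m) meanStep ν (x k)` is finite, so the distance to `m` converges too; a
positive limit would bound the drift away from zero and contradict `∑ s k = ∞`
(`tendsto_medianIterate_of_tendsto`).

*Convergence in `L^q`.* The iterates almost surely stay within one step of the range of the samples
(`medianIterate_mem_Icc`), and the conic function is Lipschitz for the taxicab distance, so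
dominated convergence applies.
-/

/-! ### The expected step direction -/

/-- The step direction on the line: `1` if the sample `p` does not exceed the position `x`,
and `-1` otherwise. -/
noncomputable def medianStep (x p : ℝ) : ℝ := if p ≤ x then 1 else -1

/-- The expected step direction at `x` for a sample of law `ν`, that is
`ν (-∞, x] - ν (x, ∞)` for a probability measure `ν`. -/
noncomputable def meanStep (ν : Measure ℝ) (x : ℝ) : ℝ := 2 * ν.real (Set.Iic x) - 1

lemma medianStep_sq (x p : ℝ) : medianStep x p ^ 2 = 1 := by
  unfold medianStep; split_ifs <;> norm_num

lemma abs_medianStep (x p : ℝ) : |medianStep x p| = 1 := by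
  unfold medianStep; split_ifs <;> norm_num

lemma measurable_medianStep : Measurable (Function.uncurry medianStep) :=
  Measurable.ite (measurableSet_le measurable_snd measurable_fst) measurable_const
    measurable_const

lemma integrable_medianStep (ν : Measure ℝ) [IsFiniteMeasure ν] (x : ℝ) :
    Integrable (medianStep x) ν :=
  Integrable.of_bound (C := 1)
    (measurable_medianStep.comp measurable_prodMk_left).aestronglyMeasurable
    (ae_of_all _ fun p => (abs_medianStep x p).le)

lemma integral_medianStep (ν : Measure ℝ) [IsProbabilityMeasure ν] (x : ℝ) :
    ∫ p, medianStep x p ∂ν = meanStep ν x := by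
  have h : medianStep x = fun p => 2 * (Set.Iic x).indicator (fun _ => (1 : ℝ)) p - 1 := by
    funext p
    by_cases hp : p ≤ x
    · simp [medianStep, hp]; norm_num
    · simp [medianStep, hp]
  rw [h, integral_sub (((integrable_const 1).indicator measurableSet_Iic).const_mul 2)
    (integrable_const 1), integral_const_mul, integral_indicator_const _ measurableSet_Iic]
  simp [meanStep]

lemma monotone_meanStep (ν : Measure ℝ) [IsFiniteMeasure ν] : Monotone (meanStep ν) := by
  intro x y hxy
  have : ν.real (Set.Iic x) ≤ ν.real (Set.Iic y) := measureReal_mono (Set.Iic_subset_Iic.2 hxy)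
  unfold meanStep; linarith

lemma abs_meanStep_le (ν : Measure ℝ) [IsProbabilityMeasure ν] (x : ℝ) : |meanStep ν x| ≤ 1 := by
  have h0 : 0 ≤ ν.real (Set.Iic x) := measureReal_nonneg
  have h1 : ν.real (Set.Iic x) ≤ 1 := measureReal_le_one
  unfold meanStep; rw [abs_le]; constructor <;> linarith

/-- `m` is the only point at which the expected step direction changes its sign, i.e. the unique
median of `ν` in a strong sense: the distribution function crosses the level `1 / 2` strictly. -/
structure IsStrictMedian (ν : Measure ℝ) (m : ℝ) : Prop where
  eq_zero : meanStep ν m = 0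
  pos : ∀ x, m < x → 0 < meanStep ν x
  neg : ∀ x, x < m → meanStep ν x < 0

lemma IsStrictMedian.mul_nonneg {ν : Measure ℝ} {m : ℝ} (h : IsStrictMedian ν m) (x : ℝ) :
    0 ≤ (x - m) * meanStep ν x := by
  rcases lt_trichotomy x m with hx | rfl | hx
  · nlinarith [h.neg x hx]
  · simp
  · nlinarith [h.pos x hx]

/-- Away from the median, the drift towards it is bounded below. -/
lemma IsStrictMedian.exists_le_mul {ν : Measure ℝ} [IsFiniteMeasure ν] {m : ℝ}
    (h : IsStrictMedian ν m) {δ : ℝ} (hδ : 0 < δ) :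
    ∃ c > 0, ∀ x, δ ≤ |x - m| → c ≤ (x - m) * meanStep ν x := by
  have h1 := h.pos (m + δ) (by linarith)
  have h2 := h.neg (m - δ) (by linarith)
  refine ⟨δ * min (meanStep ν (m + δ)) (-meanStep ν (m - δ)),
    mul_pos hδ (lt_min h1 (by linarith)), fun x hx => ?_⟩
  rcases le_abs.1 hx with hx | hx
  · have := monotone_meanStep ν (show m + δ ≤ x by linarith)
    exact mul_le_mul hx ((min_le_left _ _).trans this) (le_min h1.le (by linarith))
      (by linarith)
  · have := monotone_meanStep ν (show x ≤ m - δ by linarith)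
    calc _ ≤ (-(x - m)) * (-meanStep ν x) :=
          mul_le_mul hx ((min_le_right _ _).trans (by linarith)) (le_min h1.le (by linarith))
            (by linarith)
      _ = _ := by ring

/-! ### The algorithm on the line -/

/-- The stochastic median search `x (k + 1) = x k - s k * medianStep (x k) (q k)` on the line. -/
noncomputable def medianIterate {Ω : Type*} (x₀ : ℝ) (s : ℕ → ℝ) (q : ℕ → Ω → ℝ) :
    ℕ → Ω → ℝ
  | 0, _ => x₀
  | k + 1, ω =>
      medianIterate x₀ s q k ω - s k * medianStep (medianIterate x₀ s q k ω) (q k ω)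

/-- The `n`-th σ-algebra is generated by the samples with index less than `n`, so that it is
independent of the `n`-th sample. -/
def strictPast {Ω : Type*} {mΩ : MeasurableSpace Ω} (q : ℕ → Ω → ℝ)
    (hq : ∀ k, Measurable (q k)) : Filtration ℕ mΩ where
  seq n := ⨆ i ∈ Set.Iio n, MeasurableSpace.comap (q i) inferInstance
  mono' _ _ h := biSup_mono fun _ hi => lt_of_lt_of_le hi h
  le' _ := iSup₂_le fun i _ => (hq i).comap_le

section

variable {Ω : Type*} {mΩ : MeasurableSpace Ω} {x₀ : ℝ} {s : ℕ → ℝ} {q : ℕ → Ω → ℝ}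

lemma measurable_strictPast (hq : ∀ k, Measurable (q k)) {i n : ℕ} (h : i < n) :
    Measurable[strictPast q hq n] (q i) :=
  Measurable.of_comap_le (le_iSup₂_of_le (f := fun i (_ : i ∈ Set.Iio n) =>
    MeasurableSpace.comap (q i) inferInstance) i h le_rfl)

lemma indep_strictPast {Prob : Measure Ω} (hq : ∀ k, Measurable (q k))
    (hind : iIndepFun q Prob) (n : ℕ) :
    Indep (strictPast q hq n) (MeasurableSpace.comap (q n) inferInstance) Prob := by
  have := indep_iSup_of_disjoint (S := Set.Iio n) (T := {n}) (fun i => (hq i).comap_le)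
    ((iIndepFun_iff_iIndep ..).1 hind) (by simp)
  simpa [strictPast] using this

lemma measurable_medianIterate (hq : ∀ k, Measurable (q k)) (n : ℕ) :
    Measurable[strictPast q hq n] (medianIterate x₀ s q n) := by
  induction n with
  | zero => exact measurable_const
  | succ n ih =>
    have h1 : Measurable[strictPast q hq (n + 1)] (medianIterate x₀ s q n) :=
      ih.mono ((strictPast q hq).mono n.le_succ) le_rfl
    have h2 : Measurable[strictPast q hq (n + 1)]
        fun ω => medianStep (medianIterate x₀ s q n ω) (q n ω) :=
      measurable_medianStep.comp (h1.prodMk (measurable_strictPast hq n.lt_succ_self))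
    exact h1.sub (h2.const_mul (s n))

lemma exists_abs_medianIterate_le (x₀ : ℝ) (s : ℕ → ℝ) (q : ℕ → Ω → ℝ) (n : ℕ) :
    ∃ C, ∀ ω, |medianIterate x₀ s q n ω| ≤ C := by
  induction n with
  | zero => exact ⟨|x₀|, fun _ => le_rfl⟩
  | succ n ih =>
    obtain ⟨C, hC⟩ := ih
    refine ⟨C + |s n|, fun ω => (abs_sub _ _).trans (add_le_add (hC ω) ?_)⟩
    rw [abs_mul, abs_medianStep, mul_one]

/-- As soon as the iterate has left the range of the samples it moves back towards it, so it never
leaves that range by more than the largest step. -/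
lemma medianIterate_mem_Icc {a b T : ℝ} {ω : Ω} (hx₀ : x₀ ∈ Set.Icc a b)
    (hs0 : ∀ k, 0 ≤ s k) (hsT : ∀ k, s k ≤ T) (hq : ∀ k, q k ω ∈ Set.Icc a b) (n : ℕ) :
    medianIterate x₀ s q n ω ∈ Set.Icc (a - T) (b + T) := by
  induction n with
  | zero =>
    have := (hs0 0).trans (hsT 0)
    exact ⟨by linarith [hx₀.1, show medianIterate x₀ s q 0 ω = x₀ from rfl],
      by linarith [hx₀.2, show medianIterate x₀ s q 0 ω = x₀ from rfl]⟩
  | succ n ih =>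
    obtain ⟨h1, h2⟩ := ih
    obtain ⟨h3, h4⟩ := hq n
    have h5 := hs0 n
    have h6 := hsT n
    simp only [medianIterate, medianStep]
    split_ifs with h
    · exact ⟨by linarith, by linarith⟩
    · push Not at h
      exact ⟨by linarith, by linarith⟩

/-! ### Almost sure convergence on the line -/

/-- A function of two independent variables can be integrated in the second one first. -/
lemma integral_comp_of_indepFun {β γ : Type*} [MeasurableSpace β] [MeasurableSpace γ]
    {Prob : Measure Ω} [IsFiniteMeasure Prob] {Y : Ω → β} {Z : Ω → γ} (hY : Measurable Y)
    (hZ : Measurable Z) (hind : IndepFun Y Z Prob) {g : β → γ → ℝ}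
    (hg : Measurable (Function.uncurry g))
    (hint : Integrable (fun ω => g (Y ω) (Z ω)) Prob) :
    ∫ ω, g (Y ω) (Z ω) ∂Prob = ∫ ω, ∫ p, g (Y ω) p ∂(Prob.map Z) ∂Prob := by
  have hprod := (indepFun_iff_map_prod_eq_prod_map_map hY.aemeasurable hZ.aemeasurable).1 hind
  have hYZ := hY.prodMk hZ
  have hint' : Integrable (Function.uncurry g) ((Prob.map Y).prod (Prob.map Z)) := by
    rw [← hprod, integrable_map_measure hg.aestronglyMeasurable hYZ.aemeasurable]
    exact hint
  calc ∫ ω, g (Y ω) (Z ω) ∂Prob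
      = ∫ z, Function.uncurry g z ∂(Prob.map fun ω => (Y ω, Z ω)) :=
        (integral_map hYZ.aemeasurable hg.aestronglyMeasurable).symm
    _ = ∫ y, ∫ p, g y p ∂(Prob.map Z) ∂(Prob.map Y) := by
        rw [hprod, integral_prod _ hint']; rfl
    _ = _ := integral_map hY.aemeasurable
        hg.stronglyMeasurable.integral_prod_right.aestronglyMeasurable

/-- The squared distance to `m`, compensated by its conditional expected increments. -/
noncomputable def medianMartingale (ν : Measure ℝ) (m x₀ : ℝ) (s : ℕ → ℝ) (q : ℕ → Ω → ℝ)
    (n : ℕ) (ω : Ω) : ℝ :=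
  (medianIterate x₀ s q n ω - m) ^ 2 +
    ∑ k ∈ Finset.range n, (2 * s k * ((medianIterate x₀ s q k ω - m) *
      meanStep ν (medianIterate x₀ s q k ω)) - s k ^ 2)

lemma medianMartingale_succ (ν : Measure ℝ) (m : ℝ) (n : ℕ) (ω : Ω) :
    medianMartingale ν m x₀ s q (n + 1) ω = medianMartingale ν m x₀ s q n ω
      - 2 * s n * ((medianIterate x₀ s q n ω - m) *
        medianStep (medianIterate x₀ s q n ω) (q n ω)
        - (medianIterate x₀ s q n ω - m) * meanStep ν (medianIterate x₀ s q n ω)) := by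
  have h := medianStep_sq (medianIterate x₀ s q n ω) (q n ω)
  simp only [medianMartingale, Finset.sum_range_succ, medianIterate]
  linear_combination s n ^ 2 * h

lemma measurable_medianMartingale (ν : Measure ℝ) [IsFiniteMeasure ν] (m : ℝ)
    (hq : ∀ k, Measurable (q k)) (n : ℕ) :
    Measurable[strictPast q hq n] (medianMartingale ν m x₀ s q n) := by
  have hx : ∀ k ≤ n, Measurable[strictPast q hq n] (medianIterate x₀ s q k) := fun k hk =>
    (measurable_medianIterate hq k).mono ((strictPast q hq).mono hk) le_rfl
  refine (((hx n le_rfl).sub_const m).pow_const 2).add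
    (Finset.measurable_fun_sum _ fun k hk => ?_)
  have hk' := hx k (Finset.mem_range.1 hk).le
  exact (((hk'.sub_const m).mul ((monotone_meanStep ν).measurable.comp hk')).const_mul
    (2 * s k)).sub_const _

variable {Prob : Measure Ω} [IsProbabilityMeasure Prob] {ν : Measure ℝ} [IsProbabilityMeasure ν]

lemma integrable_drift (hq : ∀ k, Measurable (q k)) (m : ℝ) (n : ℕ) {f : Ω → ℝ}
    (hf : Measurable f) (hf1 : ∀ ω, |f ω| ≤ 1) :
    Integrable (fun ω => (medianIterate x₀ s q n ω - m) * f ω) Prob := by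
  obtain ⟨C, hC⟩ := exists_abs_medianIterate_le x₀ s q n
  have hx := (measurable_medianIterate (x₀ := x₀) (s := s) hq n).mono
    ((strictPast q hq).le n) le_rfl
  refine Integrable.of_bound (C := C + |m|)
    ((hx.sub_const m).mul hf).aestronglyMeasurable (ae_of_all _ fun ω => ?_)
  rw [Real.norm_eq_abs, abs_mul]
  have h1 : |medianIterate x₀ s q n ω - m| ≤ C + |m| :=
    (abs_sub _ _).trans (add_le_add (hC ω) le_rfl)
  nlinarith [hf1 ω, abs_nonneg (f ω), abs_nonneg (medianIterate x₀ s q n ω - m)]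

lemma integrable_drift_medianStep (hq : ∀ k, Measurable (q k)) (m : ℝ) (n : ℕ) :
    Integrable (fun ω => (medianIterate x₀ s q n ω - m) *
      medianStep (medianIterate x₀ s q n ω) (q n ω)) Prob :=
  integrable_drift hq m n (measurable_medianStep.comp
    (((measurable_medianIterate hq n).mono ((strictPast q hq).le n) le_rfl).prodMk (hq n)))
    fun _ => (abs_medianStep _ _).le

lemma integrable_drift_meanStep (hq : ∀ k, Measurable (q k)) (m : ℝ) (n : ℕ) :
    Integrable (fun ω => (medianIterate x₀ s q n ω - m) *
      meanStep ν (medianIterate x₀ s q n ω)) Prob :=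
  integrable_drift hq m n ((monotone_meanStep ν).measurable.comp
    ((measurable_medianIterate hq n).mono ((strictPast q hq).le n) le_rfl))
    fun _ => abs_meanStep_le ν _

lemma integrable_medianMartingale (hq : ∀ k, Measurable (q k)) (m : ℝ) (n : ℕ) :
    Integrable (medianMartingale ν m x₀ s q n) Prob := by
  induction n with
  | zero =>
    have : medianMartingale ν m x₀ s q 0 = fun _ => (x₀ - m) ^ 2 := by
      funext ω; simp [medianMartingale, medianIterate]
    rw [this]; exact integrable_const _
  | succ n ih =>
    have : medianMartingale ν m x₀ s q (n + 1) = _ :=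
      funext fun ω => medianMartingale_succ (x₀ := x₀) (s := s) (q := q) ν m n ω
    rw [this]
    exact ih.sub (((integrable_drift_medianStep hq m n).sub
      (integrable_drift_meanStep hq m n)).const_mul _)

/-- The sampled step and its expectation have the same mean on every event of the past, because
the current sample is independent of the past. -/
lemma setIntegral_drift (hq : ∀ k, Measurable (q k)) (hind : iIndepFun q Prob)
    (hlaw : ∀ k, Prob.map (q k) = ν) (m : ℝ) (n : ℕ) {A : Set Ω}
    (hA : MeasurableSet[strictPast q hq n] A) :
    ∫ ω in A, (medianIterate x₀ s q n ω - m) *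
      medianStep (medianIterate x₀ s q n ω) (q n ω) ∂Prob =
    ∫ ω in A, (medianIterate x₀ s q n ω - m) *
      meanStep ν (medianIterate x₀ s q n ω) ∂Prob := by
  have hA' : MeasurableSet A := (strictPast q hq).le n _ hA
  rw [← integral_indicator hA', ← integral_indicator hA']
  -- The event `A` enters through its indicator `b`, as part of the independent variable `Y`.
  let g : ℝ × ℝ → ℝ → ℝ := fun y p => y.2 * ((y.1 - m) * medianStep y.1 p)
  let Y : Ω → ℝ × ℝ := fun ω => (medianIterate x₀ s q n ω, A.indicator (fun _ => 1) ω)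
  have hg : Measurable (Function.uncurry g) := by
    have : Measurable fun z : (ℝ × ℝ) × ℝ => medianStep z.1.1 z.2 :=
      measurable_medianStep.comp ((measurable_fst.comp measurable_fst).prodMk measurable_snd)
    exact (measurable_snd.comp measurable_fst).mul
      (((measurable_fst.comp measurable_fst).sub_const m).mul this)
  have hY : Measurable[strictPast q hq n] Y :=
    (measurable_medianIterate hq n).prodMk (measurable_const.indicator hA)
  have hYq : IndepFun Y (q n) Prob :=
    (IndepFun_iff_Indep ..).2
      (indep_of_indep_of_le_left (indep_strictPast hq hind n) hY.comap_le)
  have hgY : (fun ω => g (Y ω) (q n ω)) = A.indicator fun ω =>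
      (medianIterate x₀ s q n ω - m) * medianStep (medianIterate x₀ s q n ω) (q n ω) := by
    funext ω
    by_cases hω : ω ∈ A <;> simp [g, Y, hω]
  have key := integral_comp_of_indepFun (hY.mono ((strictPast q hq).le n) le_rfl) (hq n) hYq hg
    (by rw [hgY]; exact (integrable_drift_medianStep hq m n).indicator hA')
  rw [hgY, hlaw] at key
  rw [key]
  congr 1
  funext ω
  by_cases hω : ω ∈ A <;>
    simp [g, Y, hω, integral_const_mul, integral_medianStep]

lemma martingale_medianMartingale (hq : ∀ k, Measurable (q k)) (hind : iIndepFun q Prob)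
    (hlaw : ∀ k, Prob.map (q k) = ν) (m : ℝ) :
    Martingale (medianMartingale ν m x₀ s q) (strictPast q hq) Prob := by
  refine martingale_of_setIntegral_eq_succ
    (fun n => (measurable_medianMartingale ν m hq n).stronglyMeasurable)
    (integrable_medianMartingale hq m) fun n A hA => ?_
  have h1 := (integrable_medianMartingale (x₀ := x₀) (s := s) (ν := ν) (Prob := Prob)
    hq m n).integrableOn (s := A)
  have h2 := (integrable_drift_medianStep (x₀ := x₀) (s := s) (Prob := Prob)
    hq m n).integrableOn (s := A)
  have h3 := (integrable_drift_meanStep (x₀ := x₀) (s := s) (ν := ν) (Prob := Prob)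
    hq m n).integrableOn (s := A)
  simp_rw [medianMartingale_succ]
  have h4 := h2.sub h3
  simp only [Pi.sub_def] at h4
  rw [integral_sub h1 (h4.const_mul _), integral_const_mul, integral_sub h2 h3,
    setIntegral_drift hq hind hlaw m n hA, sub_self, mul_zero, sub_zero]

/-- The compensated squared distance is bounded below by `-∑ s k ^ 2`, hence bounded in `L¹`,
and so it converges almost surely. -/
lemma ae_exists_tendsto_medianMartingale (hs0 : ∀ k, 0 ≤ s k) (hs2 : Summable fun k => s k ^ 2)
    (hq : ∀ k, Measurable (q k)) (hind : iIndepFun q Prob)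
    (hlaw : ∀ k, Prob.map (q k) = ν) {m : ℝ} (hm : IsStrictMedian ν m) :
    ∀ᵐ ω ∂Prob, ∃ c, Tendsto (fun n => medianMartingale ν m x₀ s q n ω) atTop (𝓝 c) := by
  have hM := martingale_medianMartingale (x₀ := x₀) (s := s) hq hind hlaw m
  set C := ∑' k, s k ^ 2
  have hlow : ∀ n ω, -C ≤ medianMartingale ν m x₀ s q n ω := by
    intro n ω
    have h1 : ∑ k ∈ Finset.range n, s k ^ 2 ≤ C := hs2.sum_le_tsum _ fun k _ => sq_nonneg _
    have h2 : 0 ≤ ∑ k ∈ Finset.range n, 2 * s k * ((medianIterate x₀ s q k ω - m) *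
        meanStep ν (medianIterate x₀ s q k ω)) :=
      Finset.sum_nonneg fun k _ =>
        mul_nonneg (mul_nonneg zero_le_two (hs0 k)) (hm.mul_nonneg _)
    rw [medianMartingale, Finset.sum_sub_distrib]
    nlinarith [sq_nonneg (medianIterate x₀ s q n ω - m)]
  have hC : 0 ≤ C := tsum_nonneg fun k => sq_nonneg _
  refine hM.submartingale.exists_ae_tendsto_of_bdd
    (R := ((x₀ - m) ^ 2 + 2 * C).toNNReal) fun n => ?_
  have hint := integrable_medianMartingale (x₀ := x₀) (s := s) (ν := ν) (Prob := Prob) hq m n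
  have hmean : ∫ ω, medianMartingale ν m x₀ s q n ω ∂Prob = (x₀ - m) ^ 2 := by
    have h := hM.setIntegral_eq n.zero_le MeasurableSet.univ
    rw [setIntegral_univ, setIntegral_univ] at h
    rw [← h]
    simp [medianMartingale, medianIterate]
  rw [eLpNorm_one_eq_lintegral_enorm, ← ofReal_integral_norm_eq_lintegral_enorm hint]
  refine ENNReal.ofReal_le_ofReal ?_
  calc ∫ ω, ‖medianMartingale ν m x₀ s q n ω‖ ∂Prob
      ≤ ∫ ω, (medianMartingale ν m x₀ s q n ω + 2 * C) ∂Prob :=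
        integral_mono hint.norm (hint.add (integrable_const _)) fun ω => by
          have := hlow n ω
          exact abs_le.2 ⟨by linarith, by linarith⟩
    _ = (x₀ - m) ^ 2 + 2 * C := by
        rw [integral_add hint (integrable_const _), hmean]; simp

/-- On a path along which the compensated squared distance converges, the accumulated drift stays
bounded. Hence the distance to `m` converges, and its limit is zero since `∑ s k = ∞`. -/
lemma tendsto_medianIterate_of_tendsto (hs0 : ∀ k, 0 ≤ s k)
    (hs1 : Tendsto (fun n => ∑ k ∈ Finset.range n, s k) atTop atTop)
    (hs2 : Summable fun k => s k ^ 2) {m : ℝ} (hm : IsStrictMedian ν m) {ω : Ω} {c : ℝ}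
    (hc : Tendsto (fun n => medianMartingale ν m x₀ s q n ω) atTop (𝓝 c)) :
    Tendsto (fun n => medianIterate x₀ s q n ω) atTop (𝓝 m) := by
  set d : ℕ → ℝ := fun k => (medianIterate x₀ s q k ω - m) *
    meanStep ν (medianIterate x₀ s q k ω) with hd
  have hd0 : ∀ k, 0 ≤ 2 * s k * d k := fun k =>
    mul_nonneg (mul_nonneg zero_le_two (hs0 k)) (hm.mul_nonneg _)
  -- The squared distance plus the accumulated drift.
  have hV : Tendsto (fun n => (medianIterate x₀ s q n ω - m) ^ 2 +
      ∑ k ∈ Finset.range n, 2 * s k * d k) atTop (𝓝 (c + ∑' k, s k ^ 2)) := by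
    refine (hc.add hs2.hasSum.tendsto_sum_nat).congr fun n => ?_
    simp only [medianMartingale, Finset.sum_sub_distrib, hd]
    ring
  obtain ⟨B, hB⟩ := hV.bddAbove_range
  have hsum : Summable fun k => 2 * s k * d k :=
    summable_of_sum_range_le (c := B) hd0 fun n => by
      have := hB ⟨n, rfl⟩
      simp only at this
      nlinarith [sq_nonneg (medianIterate x₀ s q n ω - m)]
  have hsq : ∃ L, Tendsto (fun n => (medianIterate x₀ s q n ω - m) ^ 2) atTop (𝓝 L) :=
    ⟨_, (hV.sub hsum.hasSum.tendsto_sum_nat).congr fun n => by ring⟩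
  obtain ⟨L, hL⟩ := hsq
  have habs : Tendsto (fun n => |medianIterate x₀ s q n ω - m|) atTop (𝓝 (Real.sqrt L)) := by
    simpa [Real.sqrt_sq_eq_abs] using hL.sqrt
  have hzero : Real.sqrt L = 0 := by
    by_contra hne
    have hpos : 0 < Real.sqrt L := lt_of_le_of_ne (Real.sqrt_nonneg L) (Ne.symm hne)
    obtain ⟨e, he, hdrift⟩ := hm.exists_le_mul (half_pos hpos)
    obtain ⟨N, hN⟩ := eventually_atTop.1 (habs.eventually (lt_mem_nhds (half_lt_self hpos)))
    -- From `N` on the drift exceeds `e`, so `∑ s k` would converge.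
    have hsumm : Summable s := by
      rw [← summable_nat_add_iff N]
      refine Summable.of_nonneg_of_le (fun k => hs0 _) (fun k => ?_)
        (((summable_nat_add_iff N).2 hsum).mul_left (2 * e)⁻¹)
      have h := hdrift _ (hN (k + N) (Nat.le_add_left _ _)).le
      have h' : e * s (k + N) ≤ d (k + N) * s (k + N) := mul_le_mul_of_nonneg_right h (hs0 _)
      rw [inv_mul_eq_div, le_div_iff₀ (by linarith)]
      linarith
    exact not_tendsto_nhds_of_tendsto_atTop hs1 _ hsumm.hasSum.tendsto_sum_nat
  rw [hzero] at habs
  have := (tendsto_zero_iff_abs_tendsto_zero _).2 habs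
  simpa using this.add_const m

lemma ae_tendsto_medianIterate (hs0 : ∀ k, 0 ≤ s k)
    (hs1 : Tendsto (fun n => ∑ k ∈ Finset.range n, s k) atTop atTop)
    (hs2 : Summable fun k => s k ^ 2)
    (hq : ∀ k, Measurable (q k)) (hind : iIndepFun q Prob)
    (hlaw : ∀ k, Prob.map (q k) = ν) {m : ℝ} (hm : IsStrictMedian ν m) :
    ∀ᵐ ω ∂Prob, Tendsto (fun n => medianIterate x₀ s q n ω) atTop (𝓝 m) := by
  filter_upwards [ae_exists_tendsto_medianMartingale (x₀ := x₀) hs0 hs2 hq hind hlaw hm]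
    with ω ⟨c, hc⟩
  exact tendsto_medianIterate_of_tendsto hs0 hs1 hs2 hm hc

end

/-! ### Existence of the median and minimality -/

lemma continuous_cdf_of_noAtoms (ν : Measure ℝ) [IsProbabilityMeasure ν]
    (hν : ∀ c, ν {c} = 0) : Continuous (cdf ν) := by
  refine continuous_iff_continuousAt.2 fun c => ?_
  rw [(monotone_cdf ν).continuousAt_iff_leftLim_eq_rightLim, StieltjesFunction.rightLim_eq]
  refine le_antisymm ((monotone_cdf ν).leftLim_le le_rfl) ?_
  have h := (cdf ν).measure_singleton c
  rw [measure_cdf, hν, eq_comm, ENNReal.ofReal_eq_zero] at h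
  linarith

/-- An atomless law that is carried by an interval and charges every neighbourhood of each of its
points has a strict median: the distribution function is continuous, and strictly increasing on that interval. -/
lemma exists_isStrictMedian {ν : Measure ℝ} [IsProbabilityMeasure ν] (hν : ∀ c, ν {c} = 0)
    {S : Set ℝ} (hS : S.OrdConnected) (hνS : ∀ᵐ y ∂ν, y ∈ S)
    (hpos : ∀ c ∈ S, ∀ ε > 0, 0 < ν (Set.Ioo (c - ε) (c + ε))) :
    ∃ m, IsStrictMedian ν m := by
  obtain ⟨m, hm⟩ : ∃ m, cdf ν m = 1 / 2 := by
    obtain ⟨a, ha⟩ := ((tendsto_cdf_atBot ν).eventually (gt_mem_nhds one_half_pos)).exists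
    obtain ⟨b, hb⟩ := ((tendsto_cdf_atTop ν).eventually (lt_mem_nhds one_half_lt_one)).exists
    exact mem_range_of_exists_le_of_exists_ge (continuous_cdf_of_noAtoms ν hν)
      ⟨a, ha.le⟩ ⟨b, hb.le⟩
  rw [cdf_eq_real] at hm
  have hmeet : ∀ s : Set ℝ, 0 < ν.real s → ∃ y ∈ S, y ∈ s := by
    intro s hs
    by_contra! hcon
    have : ν s = 0 := measure_mono_null (fun y hy hyS => hcon y hyS hy) (ae_iff.1 hνS)
    simp [Measure.real, this] at hs
  have hIoi : ν.real (Set.Ioi m) = 1 / 2 := by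
    rw [← Set.compl_Iic, probReal_compl_eq_one_sub measurableSet_Iic, hm]; norm_num
  have hIio : ν.real (Set.Iio m) = 1 / 2 := by
    rw [← hm, ← Set.Iio_insert, Set.insert_eq, measureReal_union (by simp) measurableSet_Iio,
      (measureReal_eq_zero_iff).2 (hν m), zero_add]
  obtain ⟨a, haS, ha⟩ := hmeet (Set.Iio m) (by rw [hIio]; norm_num)
  obtain ⟨b, hbS, hb⟩ := hmeet (Set.Ioi m) (by rw [hIoi]; norm_num)
  have hIoc : ∀ u v, u < v → a ≤ u → v ≤ b → 0 < ν.real (Set.Ioc u v) := by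
    intro u v huv hau hvb
    have h := hpos ((u + v) / 2) (hS.out haS hbS ⟨by linarith, by linarith⟩) ((v - u) / 2)
      (by linarith)
    refine ENNReal.toReal_pos (h.trans_le (measure_mono fun y hy => ?_)).ne' (measure_ne_top _ _)
    exact ⟨by linarith [hy.1], by linarith [hy.2]⟩
  have hsplit : ∀ u v, u ≤ v →
      ν.real (Set.Iic v) = ν.real (Set.Iic u) + ν.real (Set.Ioc u v) := by
    intro u v huv
    rw [← Set.Iic_union_Ioc_eq_Iic huv, measureReal_union _ measurableSet_Ioc]
    exact Set.disjoint_left.2 fun y hy hy' => not_lt.2 hy hy'.1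
  simp only [Set.mem_Iio, Set.mem_Ioi] at ha hb
  have h0 : meanStep ν m = 0 := by rw [meanStep, hm]; norm_num
  refine ⟨m, h0, fun x hx => ?_, fun x hx => ?_⟩
  · have h1 := hIoc m (min x b) (lt_min hx hb) ha.le (min_le_right _ _)
    have h2 := hsplit m (min x b) (lt_min hx hb).le
    refine lt_of_lt_of_le ?_ (monotone_meanStep ν (min_le_left x b))
    rw [meanStep, h2, hm]; linarith
  · have h1 := hIoc (max x a) m (max_lt hx ha) (le_max_right _ _) hb.le
    have h2 := hsplit (max x a) m (max_lt hx ha).le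
    refine lt_of_le_of_lt (monotone_meanStep ν (le_max_left x a)) ?_
    rw [hm] at h2
    rw [meanStep]; linarith

/-- The mean distance `∫ |u - a| ν(da)` of the point `u` of the line from a sample of law `ν`. -/
noncomputable def meanDist (ν : Measure ℝ) (u : ℝ) : ℝ := ∫ a, |u - a| ∂ν

section

variable {ν : Measure ℝ} [IsProbabilityMeasure ν]

lemma integrable_abs_sub (hν : Integrable (fun a => a) ν) (u : ℝ) :
    Integrable (fun a => |u - a|) ν :=
  ((integrable_const u).sub hν).abs

/-- `meanStep ν v` is a subgradient of `meanDist ν` at `v`. -/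
lemma meanDist_add_le (hν : Integrable (fun a => a) ν) (u v : ℝ) :
    meanDist ν v + (u - v) * meanStep ν v ≤ meanDist ν u := by
  rw [meanDist, meanDist, ← integral_medianStep, ← integral_const_mul,
    ← integral_add (integrable_abs_sub hν v) ((integrable_medianStep ν v).const_mul _)]
  refine integral_mono ((integrable_abs_sub hν v).add ((integrable_medianStep ν v).const_mul _))
    (integrable_abs_sub hν u) fun a => ?_
  simp only [medianStep]
  split_ifs with h
  · rw [abs_of_nonneg (sub_nonneg.2 h)]; linarith [le_abs_self (u - a)]
  · rw [abs_of_neg (sub_neg.2 (not_le.1 h))]; linarith [neg_le_abs (u - a)]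

lemma abs_meanDist_sub_le (hν : Integrable (fun a => a) ν) (u v : ℝ) :
    |meanDist ν u - meanDist ν v| ≤ |u - v| := by
  have key : ∀ u v, meanDist ν u - meanDist ν v ≤ |u - v| := fun u v => by
    have h1 := meanDist_add_le hν v u
    have h2 : (u - v) * meanStep ν u ≤ |u - v| := (le_abs_self _).trans <| by
      rw [abs_mul]
      exact mul_le_of_le_one_right (abs_nonneg _) (abs_meanStep_le ν u)
    linarith
  exact abs_le.2 ⟨by linarith [key v u, abs_sub_comm u v], key u v⟩

lemma IsStrictMedian.meanDist_lt {m u : ℝ} (hm : IsStrictMedian ν m)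
    (hν : Integrable (fun a => a) ν) (hu : u ≠ m) : meanDist ν m < meanDist ν u := by
  -- The subgradient at `m` vanishes; strictness comes from the subgradient at the midpoint.
  have h1 := meanDist_add_le hν ((u + m) / 2) m
  have h2 := meanDist_add_le hν u ((u + m) / 2)
  rw [hm.eq_zero] at h1
  have h3 : 0 < (u - (u + m) / 2) * meanStep ν ((u + m) / 2) := by
    rcases lt_or_gt_of_ne hu with h | h
    · exact mul_pos_of_neg_of_neg (by linarith) (hm.neg _ (by linarith))
    · exact mul_pos (by linarith) (hm.pos _ (by linarith))
  linarith

end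

/-! ### Reduction of the plane to its coordinates -/

lemma conicIterate_apply {Ω : Type*} (x₀ : Plane) (t : ℕ → ℝ) (P : ℕ → Ω → Plane) (k : ℕ)
    (ω : Ω) (i : Fin 2) :
    conicIterate x₀ t P k ω i =
      medianIterate (x₀ i) (fun k => t (k + 1)) (fun k ω => P (k + 1) ω i) k ω := by
  induction k with
  | zero => rfl
  | succ k ih =>
    rw [medianIterate, ← ih]
    fin_cases i <;> simp [conicIterate, stepDirection, medianStep]

lemma measurable_coord (i : Fin 2) : Measurable fun p : Plane => p i := by fun_prop

/-- The law of the `i`-th coordinate of a point of `K` chosen according to `μ`. -/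
noncomputable def coordLaw {K : Set Plane} (μ : Measure K) (i : Fin 2) : Measure ℝ :=
  μ.map fun a : K => (a : Plane) i

section

variable {K : Set Plane} {μ : Measure K}

lemma measurable_coord_coe (i : Fin 2) : Measurable fun a : K => (a : Plane) i :=
  (measurable_coord i).comp measurable_subtype_coe

instance [IsProbabilityMeasure μ] (i : Fin 2) : IsProbabilityMeasure (coordLaw μ i) :=
  Measure.isProbabilityMeasure_map (measurable_coord_coe i).aemeasurable

lemma exists_abs_coord_le (hK : IsCompact K) : ∃ R, ∀ p ∈ K, ∀ i, p i ∈ Set.Icc (-R) R := by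
  obtain ⟨R, hR⟩ := hK.isBounded.exists_norm_le
  exact ⟨R, fun p hp i => abs_le.1 ((PiLp.norm_apply_le p i).trans (hR p hp))⟩

lemma integrable_id_coordLaw [IsProbabilityMeasure μ] (hK : IsCompact K) (i : Fin 2) :
    Integrable (fun a => a) (coordLaw μ i) := by
  obtain ⟨R, hR⟩ := exists_abs_coord_le hK
  refine (integrable_map_measure measurable_id.aestronglyMeasurable
    (measurable_coord_coe i).aemeasurable).2 ?_
  exact Integrable.of_bound (C := R) (measurable_coord_coe i).aestronglyMeasurable
    (ae_of_all _ fun a => abs_le.2 (hR a a.2 i))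

/-- The taxicab distance splits, so the conic function is a sum of two functions of one
coordinate each. -/
lemma conicFunction_eq [IsProbabilityMeasure μ] (hK : IsCompact K) (p : Plane) :
    conicFunction K μ p = meanDist (coordLaw μ 0) (p 0) + meanDist (coordLaw μ 1) (p 1) := by
  have h : ∀ i : Fin 2, Integrable (fun a : K => |p i - (a : Plane) i|) μ := fun i =>
    (integrable_abs_sub (integrable_id_coordLaw (μ := μ) hK i) (p i)).comp_measurable
      (measurable_coord_coe i)
  have h' : ∀ i : Fin 2, meanDist (coordLaw μ i) (p i) = ∫ a : K, |p i - (a : Plane) i| ∂μ :=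
    fun i => integral_map (measurable_coord_coe i).aemeasurable
      (by fun_prop : Measurable fun a => |p i - a|).aestronglyMeasurable
  rw [h', h', ← integral_add (h 0) (h 1)]
  rfl

lemma abs_conicFunction_sub_le [IsProbabilityMeasure μ] (hK : IsCompact K) (p p' : Plane) :
    |conicFunction K μ p - conicFunction K μ p'| ≤ taxicabDist p p' := by
  rw [conicFunction_eq hK, conicFunction_eq hK, add_sub_add_comm]
  exact (abs_add_le _ _).trans (add_le_add
    (abs_meanDist_sub_le (integrable_id_coordLaw hK 0) _ _)
    (abs_meanDist_sub_le (integrable_id_coordLaw hK 1) _ _))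

lemma continuous_conicFunction [IsProbabilityMeasure μ] (hK : IsCompact K) :
    Continuous (conicFunction K μ) := by
  refine continuous_iff_continuousAt.2 fun p => ?_
  rw [ContinuousAt, tendsto_iff_dist_tendsto_zero]
  have hd : Continuous fun p' => taxicabDist p' p := by unfold taxicabDist; fun_prop
  exact squeeze_zero (fun _ => dist_nonneg)
    (fun p' => abs_conicFunction_sub_le hK p' p) (by simpa [taxicabDist] using hd.tendsto p)

/-- The projection of a connected set to a coordinate axis is an interval, and it is charged by
the coordinate law near each of its points. -/
lemma exists_isStrictMedian_coordLaw [IsProbabilityMeasure μ] (hK : IsCompact K)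
    (hconn : IsConnected K)
    (hpos : ∀ p ∈ K, ∀ ε : ℝ, 0 < ε → 0 < μ {a : K | (a : Plane) ∈ Metric.ball p ε})
    (i : Fin 2) (hline : ∀ c : ℝ, μ {a : K | (a : Plane) i = c} = 0) :
    ∃ m, IsStrictMedian (coordLaw μ i) m := by
  have hcont : Continuous fun p : Plane => p i := by fun_prop
  refine exists_isStrictMedian (S := (fun p : Plane => p i) '' K) (fun c => ?_)
    (hconn.image _ hcont.continuousOn).isPreconnected.ordConnected ?_ ?_
  · rw [coordLaw, Measure.map_apply (measurable_coord_coe i) (measurableSet_singleton c)]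
    exact hline c
  · refine (ae_map_iff (measurable_coord_coe i).aemeasurable
      (hK.image hcont).measurableSet).2 ?_
    exact ae_of_all _ fun a => Set.mem_image_of_mem _ a.2
  · rintro _ ⟨p, hp, rfl⟩ ε hε
    rw [coordLaw, Measure.map_apply (measurable_coord_coe i) measurableSet_Ioo]
    refine (hpos p hp ε hε).trans_le (measure_mono fun a ha => ?_)
    have h : |(a : Plane) i - p i| < ε :=
      (PiLp.norm_apply_le ((a : Plane) - p) i).trans_lt (mem_ball_iff_norm.1 ha)
    rw [abs_lt] at h
    exact ⟨by linarith [h.1], by linarith [h.2]⟩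

end

theorem mainTheorem2
    (K : Set Plane) (hK : IsCompactBody K)
    -- `K` is connected; `μ` is a probability measure on `K` that charges every ball around a
    -- point of `K` and no vertical or horizontal line
    (hconn : IsConnected K)
    (μ : Measure K) [IsProbabilityMeasure μ]
    (hpos : ∀ p ∈ K, ∀ ε : ℝ, 0 < ε → 0 < μ {a : K | (a : Plane) ∈ Metric.ball p ε})
    (hlines : ∀ c : ℝ, μ {a : K | (a : Plane) 0 = c} = 0 ∧ μ {a : K | (a : Plane) 1 = c} = 0)
    -- the step sizes `t 1, t 2, ...`
    (t : ℕ → ℝ) (ht_pos : ∀ k, 0 < t (k + 1)) (ht_anti : Antitone fun k => t (k + 1))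
    (ht_sum : Tendsto (fun n => ∑ k ∈ Finset.range n, t (k + 1)) atTop atTop)
    (ht_sq : Summable fun k => t (k + 1) ^ 2)
    -- the i.i.d. samples `P 1, P 2, ...` with common distribution `μ`
    {Ω : Type*} [MeasurableSpace Ω] (Prob : Measure Ω) [IsProbabilityMeasure Prob]
    (P : ℕ → Ω → Plane) (hP_meas : ∀ k, Measurable (P (k + 1)))
    (hP_indep : iIndepFun (fun k => P (k + 1)) Prob)
    (hP_law : ∀ k, Prob.map (P (k + 1)) = μ.map ((↑) : K → Plane))
    (x₀ : Plane) (hx₀ : x₀ ∈ K) :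
    ∃ Xstar : Plane,
      -- `Xstar` is the unique global minimizer
      (∀ p : Plane, p ≠ Xstar → conicFunction K μ Xstar < conicFunction K μ p) ∧
      -- almost sure convergence
      (∀ᵐ ω ∂Prob, Tendsto (fun k => conicFunction K μ (conicIterate x₀ t P k ω)) atTop
        (𝓝 (conicFunction K μ Xstar))) ∧
      -- convergence in `L^q` for every positive integer `q`
      (∀ q : ℕ, 1 ≤ q →
        (∀ k, MemLp (fun ω => conicFunction K μ (conicIterate x₀ t P k ω)) q Prob) ∧
        Tendsto (fun k => ∫ ω, |conicFunction K μ (conicIterate x₀ t P k ω)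
            - conicFunction K μ Xstar| ^ q ∂Prob) atTop (𝓝 0)) := by
  have hKc := hK.isCompact
  have hline : ∀ (i : Fin 2) (c : ℝ), μ {a : K | (a : Plane) i = c} = 0 := fun i c => by
    fin_cases i
    exacts [(hlines c).1, (hlines c).2]
  choose m hm using fun i => exists_isStrictMedian_coordLaw hKc hconn hpos i (hline i)
  set Xstar : Plane := !₂[m 0, m 1]
  set X := conicIterate x₀ t P
  have hXstar : ∀ i, Xstar i = m i := fun i => by fin_cases i <;> rfl
  have hF := continuous_conicFunction (μ := μ) hKc
  -- Almost sure convergence of the coordinates.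
  have hq : ∀ i k, Measurable fun ω => P (k + 1) ω i := fun i k =>
    (measurable_coord i).comp (hP_meas k)
  have hconv : ∀ i, ∀ᵐ ω ∂Prob, Tendsto (fun k => X k ω i) atTop (𝓝 (m i)) := fun i => by
    have h := ae_tendsto_medianIterate (x₀ := x₀ i) (q := fun k ω => P (k + 1) ω i)
      (fun k => (ht_pos k).le) ht_sum ht_sq (hq i)
      (hP_indep.comp (fun _ p => p i) fun _ => measurable_coord i)
      (fun k => by
        rw [coordLaw]
        exact (Measure.map_map (measurable_coord i) (hP_meas k)).symm.trans (by
          rw [hP_law k, Measure.map_map (measurable_coord i) measurable_subtype_coe]; rfl)) (hm i)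
    filter_upwards [h] with ω hω
    exact hω.congr fun k => (conicIterate_apply x₀ t P k ω i).symm
  have hconvF : ∀ᵐ ω ∂Prob, Tendsto (fun k => conicFunction K μ (X k ω)) atTop
      (𝓝 (conicFunction K μ Xstar)) := by
    filter_upwards [ae_all_iff.2 hconv] with ω hω
    have h : Tendsto (fun k => taxicabDist (X k ω) Xstar) atTop (𝓝 0) := by
      have h' : ∀ i, Tendsto (fun k => |X k ω i - Xstar i|) atTop (𝓝 0) := fun i => by
        simpa [hXstar] using ((hω i).sub_const (m i)).abs
      simpa [taxicabDist] using (h' 0).add (h' 1)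
    rw [tendsto_iff_dist_tendsto_zero]
    exact squeeze_zero (fun _ => dist_nonneg) (fun k => abs_conicFunction_sub_le hKc _ _) h
  -- Almost surely all samples lie in `K`, which bounds the iterates uniformly.
  obtain ⟨R, hR⟩ := exists_abs_coord_le hKc
  have hPK : ∀ᵐ ω ∂Prob, ∀ k, P (k + 1) ω ∈ K := ae_all_iff.2 fun k => by
    refine ae_of_ae_map (p := fun p => p ∈ K) (hP_meas k).aemeasurable ?_
    rw [hP_law k]
    refine (ae_map_iff measurable_subtype_coe.aemeasurable hKc.measurableSet).2 ?_
    exact ae_of_all _ fun a => a.2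
  set C := (R + t 1 + |m 0|) + (R + t 1 + |m 1|)
  have hbound : ∀ᵐ ω ∂Prob, ∀ k,
      |conicFunction K μ (X k ω) - conicFunction K μ Xstar| ≤ C := by
    filter_upwards [hPK] with ω hω k
    have h : ∀ i, |X k ω i - Xstar i| ≤ R + t 1 + |m i| := fun i => by
      have h' := medianIterate_mem_Icc (T := t 1) (ω := ω) (q := fun k ω => P (k + 1) ω i)
        (hR x₀ hx₀ i) (fun k => (ht_pos k).le) (fun k => ht_anti (Nat.zero_le k))
        (fun k => hR _ (hω k) i) k
      rw [← conicIterate_apply] at h'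
      rw [hXstar]
      exact (abs_sub _ _).trans
        (add_le_add (abs_le.2 ⟨by linarith [h'.1], h'.2⟩) le_rfl)
    exact (abs_conicFunction_sub_le hKc _ _).trans (add_le_add (h 0) (h 1))
  have hXmeas : ∀ k, Measurable (X k) := fun k => by
    refine (WithLp.measurable_toLp 2 _).comp (measurable_pi_lambda _ fun i => ?_)
    have h := (measurable_medianIterate (x₀ := x₀ i) (s := fun k => t (k + 1)) (hq i) k).mono
      ((strictPast _ (hq i)).le k) le_rfl
    rwa [← funext fun ω => conicIterate_apply x₀ t P k ω i] at h
  have hFmeas : ∀ k, Measurable fun ω => conicFunction K μ (X k ω) := fun k =>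
    hF.measurable.comp (hXmeas k)
  refine ⟨Xstar, fun p hp => ?_, hconvF, fun q hq1 => ⟨fun k => ?_, ?_⟩⟩
  · rw [conicFunction_eq hKc, conicFunction_eq hKc, hXstar, hXstar]
    have hle : ∀ i, meanDist (coordLaw μ i) (m i) ≤ meanDist (coordLaw μ i) (p i) := fun i => by
      rcases eq_or_ne (p i) (m i) with h | h
      · rw [h]
      · exact ((hm i).meanDist_lt (integrable_id_coordLaw hKc i) h).le
    by_cases h0 : p 0 = m 0
    · have h1 : p 1 ≠ m 1 := fun h1 => hp <| by
        ext i
        fin_cases i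
        exacts [h0, h1]
      exact add_lt_add_of_le_of_lt (hle 0)
        ((hm 1).meanDist_lt (integrable_id_coordLaw hKc 1) h1)
    · exact add_lt_add_of_lt_of_le
        ((hm 0).meanDist_lt (integrable_id_coordLaw hKc 0) h0) (hle 1)
  · refine MemLp.of_bound (hFmeas k).aestronglyMeasurable (|conicFunction K μ Xstar| + C) ?_
    filter_upwards [hbound] with ω hω
    have := abs_add_le (conicFunction K μ Xstar)
      (conicFunction K μ (X k ω) - conicFunction K μ Xstar)
    rw [add_sub_cancel] at this
    exact this.trans (by linarith [hω k])
  · have h := tendsto_integral_of_dominated_convergence (μ := Prob) (f := fun _ => (0 : ℝ))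
      (F := fun k ω => |conicFunction K μ (X k ω) - conicFunction K μ Xstar| ^ q)
      (fun _ => C ^ q)
      (fun k => (((hFmeas k).sub_const _).abs.pow_const q).aestronglyMeasurable)
      (integrable_const _) (fun k => ?_) ?_
    · simpa using h
    · filter_upwards [hbound] with ω hω
      rw [Real.norm_eq_abs, abs_pow, abs_abs]
      exact pow_le_pow_left₀ (abs_nonneg _) (hω k) q
    · filter_upwards [hconvF] with ω hω
      have h := ((hω.sub_const (conicFunction K μ Xstar)).abs).pow q
      simpa [Nat.one_le_iff_ne_zero.1 hq1] using h
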